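/- **Theorem 1.** Consider $N$ sources and $N$ users in slotted time $t=0,1,2,\dots$. In slot $t$ source $n$ is updated ($\Lambda_n(t)=1$) with probability $\lambda_n\in(0,1]$, and the channel of user $n$ is good (so that a broadcast of source $n$ in that slot would be received) with probability $p_n\in(0,1]$; all these events are independent over users and slots. A policy chooses $u_n(t)\in\{0,1\}$ (broadcast source $n$ in slot $t$ or not). It is non-anticipative: the decisions of slot $t$ depend only on the updates and channel states of earlier slots (hence on the ages up to time $t$) and possibly on independent randomization, and are independent of the updates and channel states of the slots $\ge t$. It is feasible: $\mathbb E[\sum_{n=1}^N u_n(t)]\le 1$ for all $t$; this holds in particular if at most one source is broadcast in each slot. The age of synchronization (AoS) of user $n$ is given by $s_n(0)=0$ and $$s_n(t+1)=\begin{cases}\Lambda_n(t), & \text{if } s_n(t)=0, \text{ or if } u_n(t)=1 \text{ and the broadcast succeeds},\\ s_n(t)+1, & \text{otherwise.}\end{cases}$$ For $\mu\in\mathbb R$ let $$\gamma_n(\mu)=\min\left\{\frac1{\sqrt{\left(\frac{1-\lambda_n}{\lambda_n}\right)^2-\frac{1-\lambda_n}{\lambda_n}+\frac{2\mu N}{p_n}}},\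 \lambda_n\right\},$$ where the fraction is read as $+\infty$ if the radicand is $\le 0$. If $\sum_{n}\lambda_n/p_n\ge 1$, there is $\mu^*\ge 0$ with $\sum_{n=1}^N\gamma_n(\mu^*)/p_n=1$. For every $\mu^*$ with this property, $\gamma_n^*=\gamma_n(\mu^*)$, and every feasible non-anticipative policy, $$\liminf_{T\to\infty}\mathbb E\left[\frac1{NT}\sum_{t=1}^T\sum_{n=1}^N s_n(t)\right]\ \ge\ \mathrm{AoS}_{\mathrm{LB}}=\frac1N\sum_{n=1}^N\gamma_n^*\left[\frac12\left(\frac1{\gamma_n^*}-\frac{1-\lambda_n}{\lambda_n}\right)^2+\frac12\left(\frac1{\gamma_n^*}-\frac{1-\lambda_n}{\lambda_n}\right)\right].$$ If $\sum_{n}\lambda_n/p_n<1$, the same bound holds with $\mu^*=0$, that is, with $\gamma_n^*=\lambda_n$. -/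

import Mathlib

open MeasureTheory ProbabilityTheory Filter

noncomputable section

/-- Age of synchronization of one user along one sample path, at the beginning of slot `t`.
`arr t`: the source is updated during slot `t`; `u t`: the source is broadcast in slot `t`;
`suc t`: the channel of the user is good in slot `t`, i.e. a broadcast in slot `t` would succeed.
The user is synchronized at time `0`. -/
def aos (arr suc u : ℕ → Bool) : ℕ → ℕ
  | 0 => 0
  | t + 1 =>
    if aos arr suc u t = 0 ∨ (u t = true ∧ suc t = true) then
      (if arr t = true then 1 else 0)
    else aos arr suc u t + 1

/-- The random environment of the broadcast network: in every slot, user `n` has a source update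
with probability `lam n` and a good channel with probability `p n`. All these events are independent
over users and over slots, and independent of everything known at the beginning of the slot.
`ℱ t` is the information available at the beginning of slot `t`; it contains all source updates
and channel states of earlier slots, and may contain further (private) randomness. -/
structure IsBernoulliNetwork {Ω : Type*} {m : MeasurableSpace Ω} {N : ℕ} (P : Measure Ω)
    (lam p : Fin N → ℝ) (ℱ : Filtration ℕ m) (arr suc : Fin N → ℕ → Ω → Bool) : Prop where
  arr_known : ∀ n t, Measurable[ℱ (t + 1)] (arr n t)
  suc_known : ∀ n t, Measurable[ℱ (t + 1)] (suc n t)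
  arr_prob : ∀ n t, P {ω | arr n t ω = true} = ENNReal.ofReal (lam n)
  suc_prob : ∀ n t, P {ω | suc n t ω = true} = ENNReal.ofReal (p n)
  indep_slot : ∀ t, iIndepFun
    (fun i : Fin N ⊕ Fin N => Sum.elim (fun n => arr n t) (fun n => suc n t) i) P
  indep_past : ∀ t, Indep
    (⨆ n, (MeasurableSpace.comap (arr n t) ⊤ ⊔ MeasurableSpace.comap (suc n t) ⊤)) (ℱ t) P

/-- The scheduling decisions of slot `t` only use the information available at the beginning of
slot `t`. -/
def IsNonAnticipative {Ω : Type*} {m : MeasurableSpace Ω} {N : ℕ} (ℱ : Filtration ℕ m)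
    (u : Fin N → ℕ → Ω → Bool) : Prop :=
  ∀ n t, Measurable[ℱ t] (u n t)

/-- The bandwidth constraint: in every slot the expected number of broadcasts is at most one.
In particular it holds if there is never more than one broadcast in a slot. -/
def IsFeasible {Ω : Type*} [MeasurableSpace Ω] {N : ℕ} (P : Measure Ω)
    (u : Fin N → ℕ → Ω → Bool) : Prop :=
  ∀ t, ∫ ω, ∑ n, (if u n t ω = true then (1 : ℝ) else 0) ∂P ≤ 1

/-- Expected average AoS of the network over the slots `1, …, T`. -/
def expectedAvgAoS {Ω : Type*} [MeasurableSpace Ω] {N : ℕ} (P : Measure Ω)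
    (arr suc u : Fin N → ℕ → Ω → Bool) (T : ℕ) : ℝ :=
  ∫ ω, (1 / ((N : ℝ) * (T : ℝ))) * ∑ t ∈ Finset.Icc 1 T, ∑ n,
    (aos (fun k => arr n k ω) (fun k => suc n k ω) (fun k => u n k ω) t : ℝ) ∂P

/-- `((1-λ)/λ)² - (1-λ)/λ + 2μN/p`. -/
def radicand (N : ℕ) (lam p mu : ℝ) : ℝ :=
  ((1 - lam) / lam) ^ 2 - (1 - lam) / lam + 2 * mu * N / p

/-- `min {1/√r, λ}` for the radicand `r`, where `1/√r` is read as `+∞` if `r ≤ 0`. -/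
def gammaStar (N : ℕ) (lam p mu : ℝ) : ℝ :=
  if radicand N lam p mu ≤ 0 then lam else min (1 / √(radicand N lam p mu)) lam

/-- The lower bound as a function of the delivery rates `γ`. -/
def aosLB {N : ℕ} (lam gam : Fin N → ℝ) : ℝ :=
  (1 / (N : ℝ)) * ∑ n, gam n *
    ((1 / 2) * (1 / gam n - (1 - lam n) / lam n) ^ 2
      + (1 / 2) * (1 / gam n - (1 - lam n) / lam n))

end

/-! The proof is a quadratic drift argument combined with Lagrangian duality. For one user put a =
(1-λ)/λ, and let D be the expected number of deliveries in T slots, counted only while the user is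
out of sync. A quadratic potential of the age has drift at most s - (w+1/2)·1{s≠0} +
(w²/2)·1{delivery} (`agePotential_drift`). Summing over slots, and eliminating the time in sync by
an exact balance equation (`sum_age_ge`), bounds the total expected age below by (w+1/2)(T - aD) -
w²D/2 - O(1), for every w ≥ 0. With w = 1/γ* - a this affine function of D has the target value at D
= γ*T and slope -c, where c = ((1/γ*)² - a² + a)/2. The formula for γ* is the optimality condition:
c = μN/p if γ* < λ, and c ≥ μN/p if γ* = λ, in which case D ≤ λT makes up the difference. Since D is
at most p times the expected number of broadcasts, `delivery_cost_le` charges deviations from γ*T at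
the price μN per broadcast; summed over users these charges are nonpositive by the bandwidth
constraint. What remains is an O(1/T) error. -/

/-! ### The rates as functions of the multiplier -/

/-- A closed form of `gammaStar` that is visibly continuous in the multiplier. -/
lemma gammaStar_eq {N : ℕ} {lam p mu : ℝ} (hlam : 0 < lam) :
    gammaStar N lam p mu = 1 / √(max (radicand N lam p mu) (1 / lam ^ 2)) := by
  have hl : √(1 / lam ^ 2) = 1 / lam := by
    rw [one_div, Real.sqrt_inv, Real.sqrt_sq hlam.le, one_div]
  have hl2 : 0 < 1 / lam ^ 2 := by positivity
  unfold gammaStar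
  split_ifs with h
  · rw [max_eq_right (h.trans hl2.le), hl, one_div_one_div]
  · push Not at h
    rcases le_total (radicand N lam p mu) (1 / lam ^ 2) with h' | h'
    · rw [max_eq_right h', hl, one_div_one_div, min_eq_right]
      rw [le_div_iff₀ (Real.sqrt_pos.2 h), ← le_div_iff₀' hlam, ← hl]
      exact Real.sqrt_le_sqrt h'
    · rw [max_eq_left h', min_eq_left]
      rw [div_le_iff₀ (Real.sqrt_pos.2 h), ← div_le_iff₀' hlam, ← hl]
      exact Real.sqrt_le_sqrt h'

lemma gammaStar_pos {N : ℕ} {lam p mu : ℝ} (hlam : 0 < lam) : 0 < gammaStar N lam p mu := by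
  rw [gammaStar_eq hlam]
  have : 0 < max (radicand N lam p mu) (1 / lam ^ 2) := lt_max_of_lt_right (by positivity)
  positivity

lemma gammaStar_le {N : ℕ} {lam p mu : ℝ} : gammaStar N lam p mu ≤ lam := by
  unfold gammaStar
  split_ifs
  · exact le_rfl
  · exact min_le_right _ _

lemma one_div_gammaStar_sq {N : ℕ} {lam p mu : ℝ} (hlam : 0 < lam) :
    (1 / gammaStar N lam p mu) ^ 2 = max (radicand N lam p mu) (1 / lam ^ 2) := by
  rw [gammaStar_eq hlam, one_div_one_div, Real.sq_sqrt]
  exact le_max_of_le_right (by positivity)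

lemma gammaStar_of_radicand_le {N : ℕ} {lam p mu : ℝ} (hlam : 0 < lam)
    (h : radicand N lam p mu ≤ 1 / lam ^ 2) : gammaStar N lam p mu = lam := by
  rw [gammaStar_eq hlam, max_eq_right h, one_div, one_div, Real.sqrt_inv, inv_inv,
    Real.sqrt_sq hlam.le]

lemma gammaStar_of_nonpos {N : ℕ} {lam p mu : ℝ} (hlam : 0 < lam) (hlam1 : lam ≤ 1) (hp : 0 < p)
    (hmu : mu ≤ 0) : gammaStar N lam p mu = lam := by
  have hr : radicand N lam p mu ≤ 1 / lam ^ 2 := by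
    have h1 : 2 * mu * N / p ≤ 0 := by
      apply div_nonpos_of_nonpos_of_nonneg _ hp.le
      exact mul_nonpos_of_nonpos_of_nonneg (by linarith) (Nat.cast_nonneg N)
    have h2 : 0 ≤ (1 - lam) / lam := div_nonneg (by linarith) hlam.le
    -- With a = (1-λ)/λ ≥ 0, 1/λ = 1 + a, so the radicand is at most a² - a ≤ (1+a)².
    have h3 : 1 / lam ^ 2 = (1 + (1 - lam) / lam) ^ 2 := by field_simp; ring
    unfold radicand
    rw [h3]
    nlinarith
  exact gammaStar_of_radicand_le hlam hr

lemma continuous_gammaStar {N : ℕ} {lam p : ℝ} (hlam : 0 < lam) :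
    Continuous (gammaStar N lam p) := by
  have h : gammaStar N lam p = fun mu => 1 / √(max (radicand N lam p mu) (1 / lam ^ 2)) :=
    funext fun mu => gammaStar_eq hlam
  rw [h]
  refine continuous_const.div ?_ fun mu => ?_
  · unfold radicand
    fun_prop
  · exact (Real.sqrt_pos.2 (lt_max_of_lt_right (by positivity))).ne'

lemma tendsto_gammaStar_atTop {N : ℕ} {lam p : ℝ} (hN : 0 < N) (hlam : 0 < lam) (hp : 0 < p) :
    Tendsto (gammaStar N lam p) atTop (nhds 0) := by
  have h : gammaStar N lam p = fun mu => (√(max (radicand N lam p mu) (1 / lam ^ 2)))⁻¹ :=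
    funext fun mu => by rw [gammaStar_eq hlam, one_div]
  rw [h]
  refine tendsto_inv_atTop_zero.comp (Real.tendsto_sqrt_atTop.comp ?_)
  refine tendsto_atTop_mono (fun mu => le_max_left _ _) ?_
  unfold radicand
  refine tendsto_atTop_add_const_left _ _ ?_
  have hN' : (0 : ℝ) < N := Nat.cast_pos.2 hN
  have h2 : (fun mu : ℝ => 2 * mu * N / p) = fun mu => (2 * N / p) * mu := by
    funext mu; ring
  rw [h2]
  exact tendsto_id.const_mul_atTop (by positivity)

/-- Intermediate value theorem: the sum is continuous in the multiplier, equals `∑ n, lam n / p n`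
at 0 and tends to 0 at infinity. -/
lemma exists_multiplier {N : ℕ} (lam p : Fin N → ℝ)
    (hlam : ∀ n, 0 < lam n ∧ lam n ≤ 1) (hp : ∀ n, 0 < p n ∧ p n ≤ 1)
    (h : 1 ≤ ∑ n, lam n / p n) :
    ∃ mu : ℝ, 0 ≤ mu ∧ ∑ n, gammaStar N (lam n) (p n) mu / p n = 1 := by
  have hN : 0 < N := by
    rcases Nat.eq_zero_or_pos N with rfl | hN
    · norm_num at h
    · exact hN
  have hlim : Tendsto (fun mu => ∑ n, gammaStar N (lam n) (p n) mu / p n) atTop (nhds 0) := by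
    simpa using tendsto_finsetSum Finset.univ fun n _ =>
      (tendsto_gammaStar_atTop hN (hlam n).1 (hp n).1).div_const (p n)
  have hcont : Continuous fun mu => ∑ n, gammaStar N (lam n) (p n) mu / p n :=
    continuous_finsetSum _ fun n _ => (continuous_gammaStar (hlam n).1).div_const _
  obtain ⟨M, hM, hM0⟩ := ((hlim.eventually_lt_const one_pos).and (eventually_ge_atTop 0)).exists
  have h0 : ∑ n, gammaStar N (lam n) (p n) 0 / p n = ∑ n, lam n / p n :=
    Finset.sum_congr rfl fun n _ => by
      rw [gammaStar_of_nonpos (hlam n).1 (hlam n).2 (hp n).1 le_rfl]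
  obtain ⟨mu, hmu, heq⟩ := intermediate_value_Icc' hM0 hcont.continuousOn
    (show (1 : ℝ) ∈ Set.Icc _ _ from ⟨hM.le, by rw [h0]; exact h⟩)
  exact ⟨mu, hmu.1, heq⟩

/-! ### Quadratic drift and long-run balance -/

/-- The quadratic potential with increments `s - w - 1/2` on `s ≥ 1`. -/
noncomputable def agePotential (w : ℝ) (s : ℕ) : ℝ :=
  if s = 0 then w ^ 2 / 2 else ((s : ℝ) - 1 - w) ^ 2 / 2

lemma agePotential_nonneg (w : ℝ) (s : ℕ) : 0 ≤ agePotential w s := by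
  unfold agePotential
  split_ifs <;> positivity

/-- One step of the age recursion of a single user. -/
def aosStep (s : ℕ) (arr suc u : Bool) : ℕ :=
  if s = 0 ∨ (u = true ∧ suc = true) then (if arr = true then 1 else 0) else s + 1

lemma aos_succ (arr suc u : ℕ → Bool) (t : ℕ) :
    aos arr suc u (t + 1) = aosStep (aos arr suc u t) (arr t) (suc t) (u t) := rfl

lemma aos_le (arr suc u : ℕ → Bool) (t : ℕ) : aos arr suc u t ≤ t := by
  induction t with
  | zero => exact le_rfl
  | succ t ih => rw [aos_succ, aosStep]; split_ifs <;> omega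

/-- Pathwise drift inequality for the quadratic potential. -/
lemma agePotential_drift (w : ℝ) (s : ℕ) (arr suc u : Bool) :
    agePotential w (aosStep s arr suc u) - agePotential w s ≤
      (s : ℝ) - (w + 1 / 2) * (1 - if s = 0 then 1 else 0)
        + w ^ 2 / 2 * (if s ≠ 0 ∧ u = true ∧ suc = true then 1 else 0) := by
  rcases Nat.eq_zero_or_pos s with rfl | hs
  -- The potential takes the same value at ages 0 and 1, so leaving sync costs nothing.
  · cases arr <;> simp [agePotential, aosStep]
  · have h0 : s ≠ 0 := hs.ne'
    by_cases hus : u = true ∧ suc = true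
    · have : agePotential w (aosStep s arr suc u) = w ^ 2 / 2 := by
        cases arr <;> simp [agePotential, aosStep, hus]
      rw [this]
      simp only [agePotential, h0, hus, if_false, ne_eq, not_false_eq_true, and_self, if_true]
      -- The gap between the two sides is exactly (s - w)²/2.
      nlinarith [sq_nonneg ((s : ℝ) - w)]
    · have : aosStep s arr suc u = s + 1 := by simp [aosStep, h0, hus]
      rw [this]
      simp only [agePotential, h0, hus, if_false, and_false, Nat.succ_ne_zero]
      push_cast
      nlinarith

/-- Long-run balance of a user: `z` is the probability of being synchronized, `d` the expected
number of deliveries, `e` the expected age and `Ψ` the expected potential. -/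
lemma sum_age_ge {lam w : ℝ} (hlam : 0 < lam) (hw : 0 ≤ w)
    {z d e Ψ : ℕ → ℝ} (hz0 : z 0 = 1) (hz : ∀ t, 0 ≤ z t) (hz1 : ∀ t, z t ≤ 1)
    (hrec : ∀ t, z (t + 1) = (1 - lam) * (z t + d t)) (hd : ∀ t, d t ≤ 1 - z t)
    (hΨ0 : Ψ 0 = w ^ 2 / 2) (hΨ : ∀ t, 0 ≤ Ψ t)
    (hdrift : ∀ t, Ψ (t + 1) - Ψ t ≤ e t - (w + 1 / 2) * (1 - z t) + w ^ 2 / 2 * d t) (T : ℕ) :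
    ∑ t ∈ Finset.range T, d t ≤ lam * T ∧
    (w + 1 / 2) * (T - (1 - lam) / lam * ∑ t ∈ Finset.range T, d t - 1 / lam)
      - w ^ 2 / 2 * ∑ t ∈ Finset.range T, d t - w ^ 2 / 2 ≤ ∑ t ∈ Finset.range T, e t := by
  have hdr : Ψ T - w ^ 2 / 2 ≤ ∑ t ∈ Finset.range T, e t
      - (w + 1 / 2) * (T - ∑ t ∈ Finset.range T, z t)
      + w ^ 2 / 2 * ∑ t ∈ Finset.range T, d t := by
    induction T with
    | zero => simp [hΨ0]
    | succ T ih =>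
      simp only [Finset.sum_range_succ]
      push_cast
      linarith [hdrift T]
  -- Telescopes λ z t = (1-λ) d t + z t - z (t+1).
  have hbal : lam * ∑ t ∈ Finset.range T, z t
      = (1 - lam) * ∑ t ∈ Finset.range T, d t + (1 - z T) := by
    clear hdr
    induction T with
    | zero => simp [hz0]
    | succ T ih =>
      rw [Finset.sum_range_succ, Finset.sum_range_succ, mul_add, ih, hrec]
      ring
  have hsum : ∑ t ∈ Finset.range T, d t ≤ T - ∑ t ∈ Finset.range T, z t := by
    calc _ ≤ ∑ t ∈ Finset.range T, (1 - z t) := Finset.sum_le_sum fun t _ => hd t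
      _ = _ := by simp
  generalize ∑ t ∈ Finset.range T, d t = D at *
  generalize ∑ t ∈ Finset.range T, z t = Z at *
  have hZ : Z = (1 - lam) / lam * D + (1 - z T) / lam := by
    field_simp
    linarith
  constructor
  -- Inserting the balance equation into D ≤ T - Z gives D ≤ λT - (1 - z T).
  · nlinarith [hz1 T]
  · have hZle : Z ≤ (1 - lam) / lam * D + 1 / lam := by
      rw [hZ]
      gcongr
      linarith [hz T]
    nlinarith [hΨ T, mul_nonneg (by linarith : 0 ≤ w + 1 / 2) (sub_nonneg.2 hZle)]

/-! ### One user: from the random environment to the balance equations -/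

/-- The age process of a single user. -/
def aosProcess {Ω : Type*} (arr suc u : ℕ → Ω → Bool) (t : ℕ) (ω : Ω) : ℕ :=
  aos (fun k => arr k ω) (fun k => suc k ω) (fun k => u k ω) t

section SingleUser

variable {Ω : Type*} {m : MeasurableSpace Ω} {ℱ : Filtration ℕ m} {arr suc u : ℕ → Ω → Bool}

lemma measurable_aosProcess (harr : ∀ t, Measurable[ℱ (t + 1)] (arr t))
    (hsuc : ∀ t, Measurable[ℱ (t + 1)] (suc t)) (hu : ∀ t, Measurable[ℱ t] (u t)) (t : ℕ) :
    Measurable[ℱ t] (aosProcess arr suc u t) := by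
  induction t with
  | zero => exact @measurable_const _ _ _ (ℱ 0) 0
  | succ t ih =>
    have hle : ℱ t ≤ ℱ (t + 1) := ℱ.mono t.le_succ
    exact (Measurable.of_discrete (f := fun x : ℕ × Bool × Bool × Bool =>
      aosStep x.1 x.2.1 x.2.2.1 x.2.2.2)).comp
      ((ih.mono hle le_rfl).prodMk ((harr t).prodMk ((hsuc t).prodMk ((hu t).mono hle le_rfl))))

variable {P : Measure Ω}

lemma integral_ite_eq_measureReal {p : Ω → Prop} [DecidablePred p]
    (hp : MeasurableSet {ω | p ω}) : ∫ ω, (if p ω then (1 : ℝ) else 0) ∂P = P.real {ω | p ω} := by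
  rw [← integral_indicator_one hp]
  refine integral_congr_ae (ae_of_all _ fun ω => ?_)
  by_cases h : p ω <;> simp [h]

/-- At time `t` the age is at most `t`, so any function of it takes finitely many values and is
bounded. -/
lemma integrable_comp_aosProcess [IsProbabilityMeasure P]
    (harr : ∀ t, Measurable[ℱ (t + 1)] (arr t))
    (hsuc : ∀ t, Measurable[ℱ (t + 1)] (suc t)) (hu : ∀ t, Measurable[ℱ t] (u t))
    (f : ℕ → ℝ) (t : ℕ) : Integrable (fun ω => f (aosProcess arr suc u t ω)) P := by
  have hm : Measurable fun ω => f (aosProcess arr suc u t ω) :=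
    (Measurable.of_discrete (f := f)).comp
      ((measurable_aosProcess harr hsuc hu t).mono (ℱ.le t) le_rfl)
  refine Integrable.of_bound hm.aestronglyMeasurable (∑ k ∈ Finset.range (t + 1), ‖f k‖)
    (ae_of_all _ fun ω => ?_)
  exact Finset.single_le_sum (f := fun k => ‖f k‖) (fun k _ => norm_nonneg _)
    (Finset.mem_range.2 (Nat.lt_succ_of_le (aos_le _ _ _ t)))

/-- Bounds on the deliveries and the age of a single user whose updates and channel states are
Bernoulli, independent of each other and of the past. -/
lemma singleUser_bounds [IsProbabilityMeasure P] {lam p w : ℝ} (hlam : 0 < lam)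
    (hp : 0 < p) (hp1 : p ≤ 1) (hw : 0 ≤ w)
    (harr : ∀ t, Measurable[ℱ (t + 1)] (arr t))
    (hsuc : ∀ t, Measurable[ℱ (t + 1)] (suc t)) (hu : ∀ t, Measurable[ℱ t] (u t))
    (hind_suc : ∀ t A, MeasurableSet[ℱ t] A →
      P.real ({ω | suc t ω = true} ∩ A) = p * P.real A)
    (hind_arr : ∀ t A, MeasurableSet[ℱ t] A →
      P.real ({ω | arr t ω = false} ∩ A) = (1 - lam) * P.real A)
    (hind_both : ∀ t A, MeasurableSet[ℱ t] A →
      P.real (({ω | arr t ω = false} ∩ {ω | suc t ω = true}) ∩ A) = (1 - lam) * p * P.real A)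
    (T : ℕ) :
    ∃ D : ℝ, D ≤ lam * T ∧ D ≤ p * ∑ t ∈ Finset.range T, P.real {ω | u t ω = true} ∧
    (w + 1 / 2) * (T - (1 - lam) / lam * D - 1 / lam) - w ^ 2 / 2 * D - w ^ 2 / 2 ≤
      ∑ t ∈ Finset.range T, ∫ ω, (aosProcess arr suc u t ω : ℝ) ∂P := by
  set s := aosProcess arr suc u with hs
  have hsm : ∀ t, Measurable[ℱ t] (s t) := measurable_aosProcess harr hsuc hu
  have hint : ∀ (f : ℕ → ℝ) t, Integrable (fun ω => f (s t ω)) P :=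
    integrable_comp_aosProcess harr hsuc hu
  have hstep : ∀ t ω, s (t + 1) ω = aosStep (s t ω) (arr t ω) (suc t ω) (u t ω) := fun t ω => rfl
  have hZ : ∀ t, MeasurableSet[ℱ t] {ω | s t ω = 0} := fun t =>
    hsm t (measurableSet_singleton 0)
  have hQ : ∀ t, MeasurableSet[ℱ t] {ω | s t ω ≠ 0 ∧ u t ω = true} := fun t =>
    (hZ t).compl.inter (hu t (measurableSet_singleton true))
  have hS : ∀ t, MeasurableSet {ω | suc t ω = true} := fun t =>
    ℱ.le _ _ (hsuc t (measurableSet_singleton true))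
  have hA : ∀ t, MeasurableSet {ω | arr t ω = false} := fun t =>
    ℱ.le _ _ (harr t (measurableSet_singleton false))
  -- Age and decision are known at the start of the slot, so channel success factors out.
  have hdel : ∀ t, P.real {ω | s t ω ≠ 0 ∧ u t ω = true ∧ suc t ω = true}
      = p * P.real {ω | s t ω ≠ 0 ∧ u t ω = true} := fun t => by
    rw [← hind_suc t _ (hQ t)]
    congr 1
    ext ω
    simp only [Set.mem_ofPred_eq, Set.mem_inter_iff]
    tauto
  have hdelm : ∀ t, MeasurableSet {ω | s t ω ≠ 0 ∧ u t ω = true ∧ suc t ω = true} := fun t => by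
    have : {ω | s t ω ≠ 0 ∧ u t ω = true ∧ suc t ω = true}
        = {ω | s t ω ≠ 0 ∧ u t ω = true} ∩ {ω | suc t ω = true} := by
      ext ω
      simp only [Set.mem_ofPred_eq, Set.mem_inter_iff]
      tauto
    rw [this]
    exact (ℱ.le _ _ (hQ t)).inter (hS t)
  have key := sum_age_ge hlam hw
    (z := fun t => P.real {ω | s t ω = 0})
    (d := fun t => p * P.real {ω | s t ω ≠ 0 ∧ u t ω = true})
    (e := fun t => ∫ ω, (s t ω : ℝ) ∂P)
    (Ψ := fun t => ∫ ω, agePotential w (s t ω) ∂P)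
    (by simp [hs, aosProcess, aos])
    (fun t => measureReal_nonneg) (fun t => measureReal_le_one) ?_ ?_
    (by simp [hs, aosProcess, aos, agePotential])
    (fun t => integral_nonneg fun ω => agePotential_nonneg w _) ?_ T
  · refine ⟨_, key.1, ?_, key.2⟩
    rw [← Finset.mul_sum]
    exact mul_le_mul_of_nonneg_left
      (Finset.sum_le_sum fun t _ => measureReal_mono fun ω h => h.2) hp.le
  · intro t
    -- The next slot starts in sync exactly when no update arrives and the user was in sync or
    -- received a delivery; the two cases are disjoint.
    have hunion : {ω | s (t + 1) ω = 0} = ({ω | arr t ω = false} ∩ {ω | s t ω = 0}) ∪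
        (({ω | arr t ω = false} ∩ {ω | suc t ω = true}) ∩ {ω | s t ω ≠ 0 ∧ u t ω = true}) := by
      ext ω
      simp only [Set.mem_ofPred_eq, Set.mem_inter_iff, Set.mem_union, hstep, aosStep]
      cases arr t ω <;> cases suc t ω <;> cases u t ω <;> by_cases h : s t ω = 0 <;> simp [h]
    rw [hunion, measureReal_union, hind_arr t _ (hZ t), hind_both t _ (hQ t)]
    · ring
    · exact Set.disjoint_left.2 fun ω h1 h2 => h2.2.1 h1.2
    · exact ((hA t).inter (hS t)).inter (ℱ.le _ _ (hQ t))
  · intro t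
    have h1 : P.real {ω | s t ω ≠ 0 ∧ u t ω = true} ≤ P.real {ω | s t ω = 0}ᶜ :=
      measureReal_mono fun ω h => h.1
    rw [probReal_compl_eq_one_sub (ℱ.le _ _ (hZ t))] at h1
    exact (mul_le_of_le_one_left measureReal_nonneg hp1).trans h1
  · intro t
    have hi1 : Integrable (fun ω => (if s t ω = 0 then (1 : ℝ) else 0)) P :=
      hint (fun k => if k = 0 then 1 else 0) t
    have hi2 : Integrable
        (fun ω => if s t ω ≠ 0 ∧ u t ω = true ∧ suc t ω = true then (1 : ℝ) else 0) P := by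
      refine ((integrable_const (1 : ℝ)).indicator (hdelm t)).congr (ae_of_all _ fun ω => ?_)
      simp [Set.indicator]
    have hi0 := hint (fun k => (k : ℝ)) t
    have hle := integral_mono ((hint (agePotential w) (t + 1)).sub (hint (agePotential w) t))
      ((hi0.sub (((integrable_const (1 : ℝ)).sub hi1).const_mul (w + 1 / 2))).add
        (hi2.const_mul (w ^ 2 / 2)))
      (fun ω => by
        simp only [Pi.sub_apply, Pi.add_apply, hstep]
        exact agePotential_drift w (s t ω) (arr t ω) (suc t ω) (u t ω))
    rw [integral_sub' (hint _ _) (hint _ _), integral_add' (hi0.sub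
      (((integrable_const (1 : ℝ)).sub hi1).const_mul (w + 1 / 2))) (hi2.const_mul (w ^ 2 / 2)),
      integral_sub' hi0 (((integrable_const (1 : ℝ)).sub hi1).const_mul (w + 1 / 2)),
      integral_const_mul, integral_const_mul, integral_ite_eq_measureReal (hdelm t), hdel] at hle
    simp only [Pi.sub_apply] at hle
    rw [integral_sub (integrable_const _) hi1,
      integral_ite_eq_measureReal (ℱ.le _ _ (hZ t)), integral_const] at hle
    simpa using hle

end SingleUser

/-! ### Independence in the network, passed to each user -/

section Network

variable {Ω : Type*} {m : MeasurableSpace Ω} {N : ℕ} {P : Measure Ω}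
  {lam p : Fin N → ℝ} {ℱ : Filtration ℕ m} {arr suc : Fin N → ℕ → Ω → Bool}

namespace IsBernoulliNetwork

lemma measurable_arr (h : IsBernoulliNetwork P lam p ℱ arr suc)
    (n : Fin N) (t : ℕ) : Measurable (arr n t) :=
  (h.arr_known n t).mono (ℱ.le _) le_rfl

lemma real_suc (h : IsBernoulliNetwork P lam p ℱ arr suc)
    (hp : ∀ n, 0 < p n ∧ p n ≤ 1) (n : Fin N) (t : ℕ) :
    P.real {ω | suc n t ω = true} = p n := by
  rw [measureReal_def, h.suc_prob, ENNReal.toReal_ofReal (hp n).1.le]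

lemma real_not_arr [IsProbabilityMeasure P]
    (h : IsBernoulliNetwork P lam p ℱ arr suc)
    (hlam : ∀ n, 0 < lam n ∧ lam n ≤ 1) (n : Fin N) (t : ℕ) :
    P.real {ω | arr n t ω = false} = 1 - lam n := by
  have hm : MeasurableSet {ω | arr n t ω = true} :=
    h.measurable_arr n t (measurableSet_singleton true)
  have : {ω | arr n t ω = false} = {ω | arr n t ω = true}ᶜ := by
    ext ω
    simp
  rw [this, probReal_compl_eq_one_sub hm, measureReal_def, h.arr_prob,
    ENNReal.toReal_ofReal (hlam n).1.le]

lemma real_inter_past (h : IsBernoulliNetwork P lam p ℱ arr suc)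
    {t : ℕ} (n : Fin N) {A B : Set Ω}
    (hB : MeasurableSet[MeasurableSpace.comap (arr n t) ⊤ ⊔ MeasurableSpace.comap (suc n t) ⊤] B)
    (hA : MeasurableSet[ℱ t] A) : P.real (B ∩ A) = P.real B * P.real A := by
  have hB' := le_iSup (fun n => MeasurableSpace.comap (arr n t) ⊤ ⊔
    MeasurableSpace.comap (suc n t) ⊤) n B hB
  rw [measureReal_def, (Indep_iff _ _ P).1 (h.indep_past t) B A hB' hA, ENNReal.toReal_mul]
  rfl

lemma real_not_arr_inter_suc [IsProbabilityMeasure P]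
    (h : IsBernoulliNetwork P lam p ℱ arr suc)
    (hlam : ∀ n, 0 < lam n ∧ lam n ≤ 1) (hp : ∀ n, 0 < p n ∧ p n ≤ 1)
    (n : Fin N) (t : ℕ) :
    P.real ({ω | arr n t ω = false} ∩ {ω | suc n t ω = true}) = (1 - lam n) * p n := by
  have hi : IndepFun (arr n t) (suc n t) P :=
    (h.indep_slot t).indepFun (i := Sum.inl n) (j := Sum.inr n) (by simp)
  have := hi.measure_inter_preimage_eq_mul {false} {true}
    (measurableSet_singleton _) (measurableSet_singleton _)
  rw [← h.real_not_arr hlam n t, ← h.real_suc hp n t, measureReal_def, measureReal_def,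
    measureReal_def, ← ENNReal.toReal_mul]
  exact congrArg ENNReal.toReal this

/-- The bounds of `singleUser_bounds` for every user of the network. -/
lemma user_bounds [IsProbabilityMeasure P]
    (h : IsBernoulliNetwork P lam p ℱ arr suc)
    (hlam : ∀ n, 0 < lam n ∧ lam n ≤ 1) (hp : ∀ n, 0 < p n ∧ p n ≤ 1)
    {u : Fin N → ℕ → Ω → Bool} (hu : IsNonAnticipative ℱ u) (n : Fin N) {w : ℝ} (hw : 0 ≤ w)
    (T : ℕ) :
    ∃ D : ℝ, D ≤ lam n * T ∧ D ≤ p n * ∑ t ∈ Finset.range T, P.real {ω | u n t ω = true} ∧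
    (w + 1 / 2) * (T - (1 - lam n) / lam n * D - 1 / lam n) - w ^ 2 / 2 * D - w ^ 2 / 2 ≤
      ∑ t ∈ Finset.range T, ∫ ω, (aosProcess (arr n) (suc n) (u n) t ω : ℝ) ∂P := by
  have hSm : ∀ t, MeasurableSet[MeasurableSpace.comap (arr n t) ⊤ ⊔
      MeasurableSpace.comap (suc n t) ⊤] {ω | suc n t ω = true} := fun t =>
    le_sup_right (a := MeasurableSpace.comap (arr n t) ⊤) _
      ⟨{true}, measurableSet_singleton _, rfl⟩
  have hAm : ∀ t, MeasurableSet[MeasurableSpace.comap (arr n t) ⊤ ⊔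
      MeasurableSpace.comap (suc n t) ⊤] {ω | arr n t ω = false} := fun t =>
    le_sup_left (b := MeasurableSpace.comap (suc n t) ⊤) _
      ⟨{false}, measurableSet_singleton _, rfl⟩
  refine singleUser_bounds (hlam n).1 (hp n).1 (hp n).2 hw (h.arr_known n) (h.suc_known n)
    (hu n) ?_ ?_ ?_ T
  · intro t A hA
    rw [h.real_inter_past n (hSm t) hA, h.real_suc hp]
  · intro t A hA
    rw [h.real_inter_past n (hAm t) hA, h.real_not_arr hlam]
  · intro t A hA
    rw [h.real_inter_past n ((hAm t).inter (hSm t)) hA, h.real_not_arr_inter_suc hlam hp]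

end IsBernoulliNetwork

end Network

/-! ### Lagrangian pricing and the network bound -/

/-- Lagrangian estimate for one user: `D` deliveries and `U` expected broadcasts in `T` slots. -/
lemma delivery_cost_le {N : ℕ} {lam p mu D U T : ℝ} (hlam : 0 < lam)
    (hp : 0 < p) (hmu : 0 ≤ mu) (hD : D ≤ lam * T) (hU : D ≤ p * U) :
    ((1 / gammaStar N lam p mu) ^ 2 - ((1 - lam) / lam) ^ 2 + (1 - lam) / lam) / 2 * D ≤
      ((1 / gammaStar N lam p mu) ^ 2 - ((1 - lam) / lam) ^ 2 + (1 - lam) / lam) / 2 *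
        (gammaStar N lam p mu * T) + mu * N * (U - gammaStar N lam p mu / p * T) := by
  have hν : 0 ≤ mu * N / p := by positivity
  have hνU : mu * N / p * D ≤ mu * N * U := by
    calc mu * N / p * D ≤ mu * N / p * (p * U) := by gcongr
      _ = mu * N * U := by field_simp
  have hνγ : mu * N * (gammaStar N lam p mu / p * T)
      = mu * N / p * (gammaStar N lam p mu * T) := by ring
  have hr : radicand N lam p mu
      = ((1 - lam) / lam) ^ 2 - (1 - lam) / lam + 2 * (mu * N / p) := by
    unfold radicand; ring
  have hsq := one_div_gammaStar_sq (N := N) (p := p) (mu := mu) hlam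
  rcases le_total (1 / lam ^ 2) (radicand N lam p mu) with h | h
  -- Unclipped rate: the slope equals the price per delivery, so only D ≤ pU is needed.
  · have hc : ((1 / gammaStar N lam p mu) ^ 2 - ((1 - lam) / lam) ^ 2 + (1 - lam) / lam) / 2
        = mu * N / p := by
      rw [hsq, max_eq_left h, hr]; ring
    rw [hc]
    linarith
  -- Clipped rate: the excess of the slope over the price is paid for by D ≤ λT.
  · have hγ : gammaStar N lam p mu = lam := gammaStar_of_radicand_le hlam h
    have hc : mu * N / p ≤
        ((1 / gammaStar N lam p mu) ^ 2 - ((1 - lam) / lam) ^ 2 + (1 - lam) / lam) / 2 := by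
      have := le_max_left (radicand N lam p mu) (1 / lam ^ 2)
      rw [← hsq] at this
      linarith
    generalize ((1 / gammaStar N lam p mu) ^ 2 - ((1 - lam) / lam) ^ 2 + (1 - lam) / lam) / 2
      = c at *
    rw [hγ] at hνγ ⊢
    nlinarith [mul_le_mul_of_nonneg_left hD (sub_nonneg.2 hc)]

/-- Reconciles the drift sum over slots 0, …, T-1 with the average over 1, …, T; the age at time 0
vanishes. -/
lemma sum_range_le_sum_Icc {f : ℕ → ℝ} (h0 : f 0 = 0) (hf : ∀ t, 0 ≤ f t) (T : ℕ) :
    ∑ t ∈ Finset.range T, f t ≤ ∑ t ∈ Finset.Icc 1 T, f t := by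
  have h : ∑ t ∈ Finset.range T, f t + f T = ∑ t ∈ Finset.Icc 1 T, f t := by
    induction T with
    | zero => simp [h0]
    | succ T ih => rw [Finset.sum_range_succ, ih, Finset.sum_Icc_succ_top (by omega)]
  linarith [hf T]

section Network

variable {Ω : Type*} {m : MeasurableSpace Ω} {N : ℕ} {P : Measure Ω} [IsProbabilityMeasure P]
  {lam p : Fin N → ℝ} {ℱ : Filtration ℕ m} {arr suc u : Fin N → ℕ → Ω → Bool}

lemma IsFeasible.sum_le_one (hfeas : IsFeasible P u) (hu : IsNonAnticipative ℱ u) (t : ℕ) :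
    ∑ n, P.real {ω | u n t ω = true} ≤ 1 := by
  have hm : ∀ n, MeasurableSet {ω | u n t ω = true} := fun n =>
    ℱ.le _ _ (hu n t (measurableSet_singleton true))
  have h := hfeas t
  rw [integral_finsetSum] at h
  · simpa only [integral_ite_eq_measureReal (hm _)] using h
  · intro n _
    refine ((integrable_const (1 : ℝ)).indicator (hm n)).congr (ae_of_all _ fun ω => ?_)
    simp [Set.indicator]

lemma IsBernoulliNetwork.expectedAvgAoS_eq (h : IsBernoulliNetwork P lam p ℱ arr suc)
    (hu : IsNonAnticipative ℱ u) (T : ℕ) :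
    expectedAvgAoS P arr suc u T = (1 / ((N : ℝ) * (T : ℝ))) *
      ∑ n, ∑ t ∈ Finset.Icc 1 T, ∫ ω, (aosProcess (arr n) (suc n) (u n) t ω : ℝ) ∂P := by
  have hint : ∀ n t, Integrable (fun ω => (aosProcess (arr n) (suc n) (u n) t ω : ℝ)) P :=
    fun n t => integrable_comp_aosProcess (h.arr_known n) (h.suc_known n) (hu n) (fun k => (k : ℝ)) t
  unfold expectedAvgAoS
  rw [integral_const_mul, Finset.sum_comm]
  congr 1
  refine (integral_finsetSum _ fun t _ => integrable_finsetSum _ fun n _ => hint n t).trans ?_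
  exact Finset.sum_congr rfl fun t _ => integral_finsetSum _ fun n _ => hint n t

/-- Finite-horizon bound: the expected average AoS is at least the lower bound up to `O(1/T)`. -/
lemma IsBernoulliNetwork.exists_aosLB_sub_le (h : IsBernoulliNetwork P lam p ℱ arr suc)
    (hlam : ∀ n, 0 < lam n ∧ lam n ≤ 1) (hp : ∀ n, 0 < p n ∧ p n ≤ 1)
    (hu : IsNonAnticipative ℱ u) (hfeas : IsFeasible P u) {mu : ℝ} (hmu : 0 ≤ mu)
    (hslack : mu ≤ mu * ∑ n, gammaStar N (lam n) (p n) mu / p n) :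
    ∃ C : ℝ, ∀ T : ℕ, 0 < T →
      aosLB lam (fun n => gammaStar N (lam n) (p n) mu) - C / T ≤
        expectedAvgAoS P arr suc u T := by
  set γ : Fin N → ℝ := fun n => gammaStar N (lam n) (p n) mu with hγ
  set a : Fin N → ℝ := fun n => (1 - lam n) / lam n with ha
  set w : Fin N → ℝ := fun n => 1 / γ n - a n with hw
  have hγpos : ∀ n, 0 < γ n := fun n => gammaStar_pos (hlam n).1
  have hw0 : ∀ n, 0 ≤ w n := fun n => by
    have h1 : 1 / lam n ≤ 1 / γ n := one_div_le_one_div_of_le (hγpos n) gammaStar_le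
    have h2 : 1 / lam n = 1 + a n := by
      have := (hlam n).1
      simp only [ha]; field_simp; ring
    simp only [hw]
    linarith
  -- Boundary terms of `sum_age_ge`: the 1/λ from the balance equation and the initial potential
  -- w²/2.
  set K : Fin N → ℝ := fun n => (w n + 1 / 2) * (1 / lam n) + w n ^ 2 / 2 with hK
  refine ⟨1 / N * ∑ n, K n, fun T hT => ?_⟩
  have hT' : (0 : ℝ) < T := Nat.cast_pos.2 hT
  set U : Fin N → ℝ := fun n => ∑ t ∈ Finset.range T, P.real {ω | u n t ω = true} with hU
  have huser : ∀ n, T * (γ n * (1 / 2 * w n ^ 2 + 1 / 2 * w n)) - K n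
      - mu * N * (U n - γ n / p n * T) ≤
      ∑ t ∈ Finset.Icc 1 T, ∫ ω, (aosProcess (arr n) (suc n) (u n) t ω : ℝ) ∂P := fun n => by
    obtain ⟨D, hD1, hD2, hD3⟩ := h.user_bounds hlam hp hu n (hw0 n) T
    refine le_trans ?_ (hD3.trans (sum_range_le_sum_Icc (by simp [aosProcess, aos])
      (fun t => integral_nonneg fun ω => Nat.cast_nonneg _) T))
    have hcost := delivery_cost_le (N := N) (hlam n).1 (hp n).1 hmu hD1 hD2
    change ((1 / γ n) ^ 2 - a n ^ 2 + a n) / 2 * D ≤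
      ((1 / γ n) ^ 2 - a n ^ 2 + a n) / 2 * (γ n * T) + mu * N * (U n - γ n / p n * T) at hcost
    change _ ≤ (w n + 1 / 2) * (T - a n * D - 1 / lam n) - w n ^ 2 / 2 * D - w n ^ 2 / 2
    have hg : 1 / γ n = w n + a n := by simp only [hw]; ring
    have hg1 : γ n * (w n + a n) = 1 := by
      rw [← hg]; exact mul_one_div_cancel (hγpos n).ne'
    rw [hg] at hcost
    -- At D = γT the affine bound takes the target value; this uses γ(w + a) = 1.
    have hvalue : ((w n + a n) ^ 2 - a n ^ 2 + a n) / 2 * (γ n * T)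
        = (w n + 1 / 2) * T - T * (γ n * (1 / 2 * w n ^ 2 + 1 / 2 * w n)) := by
      linear_combination (w n + 1 / 2) * T * hg1
    simp only [hK]
    rw [hvalue] at hcost
    linarith
  have hUsum : ∑ n, U n ≤ T := by
    simp only [hU]
    rw [Finset.sum_comm]
    calc _ ≤ ∑ t ∈ Finset.range T, (1 : ℝ) := Finset.sum_le_sum fun t _ => hfeas.sum_le_one hu t
      _ = T := by simp
  -- `hslack` is the part of complementary slackness needed here; it covers both a tight constraint
  -- and a zero multiplier.
  have hpen : ∑ n, mu * N * (U n - γ n / p n * T) ≤ 0 := by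
    rw [← Finset.mul_sum, Finset.sum_sub_distrib, ← Finset.sum_mul]
    have h1 : mu * ∑ n, U n ≤ mu * T := mul_le_mul_of_nonneg_left hUsum hmu
    have h2 : mu * T ≤ mu * (∑ n, γ n / p n) * T := mul_le_mul_of_nonneg_right hslack hT'.le
    have h3 : mu * (∑ n, U n - (∑ n, γ n / p n) * T) ≤ 0 := by linarith
    calc _ = N * (mu * (∑ n, U n - (∑ n, γ n / p n) * T)) := by ring
      _ ≤ 0 := mul_nonpos_of_nonneg_of_nonpos (Nat.cast_nonneg N) h3
  have hsum := Finset.sum_le_sum fun n (_ : n ∈ Finset.univ) => huser n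
  rw [Finset.sum_sub_distrib, Finset.sum_sub_distrib, ← Finset.mul_sum] at hsum
  rw [h.expectedAvgAoS_eq hu]
  have hLB : aosLB lam γ = 1 / N * ∑ n, γ n * (1 / 2 * w n ^ 2 + 1 / 2 * w n) := rfl
  rw [hLB]
  calc _ = 1 / ((N : ℝ) * T) *
        (T * ∑ n, γ n * (1 / 2 * w n ^ 2 + 1 / 2 * w n) - ∑ n, K n) := by
        rw [one_div_mul_eq_div, one_div_mul_eq_div, one_div_mul_eq_div, sub_div,
          mul_comm (N : ℝ), mul_div_mul_left _ _ hT'.ne', div_div, mul_comm (N : ℝ)]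
    _ ≤ _ := by
        gcongr
        linarith

/-- Taking the liminf in `EReal` keeps it meaningful when the averages are unbounded. -/
lemma IsBernoulliNetwork.aosLB_le_liminf (h : IsBernoulliNetwork P lam p ℱ arr suc)
    (hlam : ∀ n, 0 < lam n ∧ lam n ≤ 1) (hp : ∀ n, 0 < p n ∧ p n ≤ 1)
    (hu : IsNonAnticipative ℱ u) (hfeas : IsFeasible P u) {mu : ℝ} (hmu : 0 ≤ mu)
    (hslack : mu ≤ mu * ∑ n, gammaStar N (lam n) (p n) mu / p n) :
    ((aosLB lam (fun n => gammaStar N (lam n) (p n) mu) : ℝ) : EReal) ≤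
      liminf (fun T : ℕ => ((expectedAvgAoS P arr suc u T : ℝ) : EReal)) atTop := by
  obtain ⟨C, hC⟩ := h.exists_aosLB_sub_le hlam hp hu hfeas hmu hslack
  have hlim : Tendsto (fun T : ℕ =>
      ((aosLB lam (fun n => gammaStar N (lam n) (p n) mu) - C / T : ℝ) : EReal)) atTop
      (nhds ((aosLB lam (fun n => gammaStar N (lam n) (p n) mu) : ℝ) : EReal)) := by
    refine (continuous_coe_real_ereal.tendsto _).comp ?_
    simpa using (tendsto_const_nhds (x := aosLB lam (fun n => gammaStar N (lam n) (p n) mu))).sub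
      (tendsto_const_div_atTop_nhds_zero_nat C)
  rw [← hlim.liminf_eq]
  refine liminf_le_liminf ?_
  filter_upwards [eventually_gt_atTop 0] with T hT
  exact EReal.coe_le_coe_iff.2 (hC T hT)

end Network

/-- Lower bound for the long-run expected average AoS. First part: a multiplier `mu` exists as soon
as `∑ λ_n / p_n ≥ 1`. Second part: the bound, for every such multiplier. Third part: if
`∑ λ_n / p_n < 1`, the bandwidth constraint is slack, `mu = 0` and `γ_n = λ_n`. -/
theorem theorem1 {N : ℕ} (lam p : Fin N → ℝ)
    (hlam : ∀ n, 0 < lam n ∧ lam n ≤ 1) (hp : ∀ n, 0 < p n ∧ p n ≤ 1) :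
    (1 ≤ ∑ n, lam n / p n →
      ∃ mu : ℝ, 0 ≤ mu ∧ ∑ n, gammaStar N (lam n) (p n) mu / p n = 1) ∧
    ∀ {Ω : Type*} {m : MeasurableSpace Ω} (P : Measure Ω) [IsProbabilityMeasure P]
      (ℱ : Filtration ℕ m) (arr suc u : Fin N → ℕ → Ω → Bool),
      IsBernoulliNetwork P lam p ℱ arr suc → IsNonAnticipative ℱ u → IsFeasible P u →
      (∀ mu : ℝ, ∑ n, gammaStar N (lam n) (p n) mu / p n = 1 →
        ((aosLB lam (fun n => gammaStar N (lam n) (p n) mu) : ℝ) : EReal) ≤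
          liminf (fun T : ℕ => ((expectedAvgAoS P arr suc u T : ℝ) : EReal)) atTop) ∧
      (∑ n, lam n / p n < 1 →
        ((aosLB lam (fun n => gammaStar N (lam n) (p n) 0) : ℝ) : EReal) ≤
          liminf (fun T : ℕ => ((expectedAvgAoS P arr suc u T : ℝ) : EReal)) atTop) := by
  refine ⟨exists_multiplier lam p hlam hp, fun P _ ℱ arr suc u h hu hfeas => ⟨?_, fun _ => ?_⟩⟩
  · intro mu hmu
    rcases le_total 0 mu with h0 | h0
    · exact h.aosLB_le_liminf hlam hp hu hfeas h0 (by rw [hmu, mul_one])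
    -- For a nonpositive multiplier every rate is clipped at λ, so it may be replaced by 0.
    · have heq : (fun n => gammaStar N (lam n) (p n) mu) = fun n => gammaStar N (lam n) (p n) 0 :=
        funext fun n => by
          rw [gammaStar_of_nonpos (hlam n).1 (hlam n).2 (hp n).1 h0,
            gammaStar_of_nonpos (hlam n).1 (hlam n).2 (hp n).1 le_rfl]
      rw [heq]
      exact h.aosLB_le_liminf hlam hp hu hfeas le_rfl (by simp)
  · exact h.aosLB_le_liminf hlam hp hu hfeas le_rfl (by simp)
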